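/- **Stateful firewall on a Tofino switch.** *Switch model.* Time $t\in\mathbb Z$ is measured in clock ticks; let $\tau\ge 1$ be the number of ticks per millisecond and $D=10\tau$. A switch consists of an ingress side (packet generator, input ports, ingress pipeline = parser, control block, deparser, mirror session lookup and mirror buffer merge, packet replication engine, queue admission control) and an egress side (packet scheduler, egress pipeline, output ports), composed as state-transition relations. A run is a finite sequence of ingress steps (one clock tick each) and egress steps (no time passes) in any interleaving. In an ingress step the packet generator emits the recirculated packet if there is one, and otherwise the packet (if any) that its generation function produces at this tick; in either case the recirculation register is left empty. If the generator emits a packet, the input ports pass it to the ingress pipeline; otherwise they pass on an arbitrary one of the packets received by the switch, or nothing. If the parser rejects a packet, the packet disappears. Queue admission may discard any copies of a packet, the scheduler may take any queued packet. Mirroring is specified only for the empty mirror configuration. The *flow* of a run is the sequence of packets, with their times, that enter the ingress pipeline. A sequence of packets in the time interval from $t_0$ to $t_1$ is *dense* if the sequence formed by $t_0$, the times of the packets, and $t_1$ is non-decreasing, with consecutive differences at most $D$ (no gap longer than 10 ms). *Configuration.* The packet generator has a periodic timer of $D$ ticks with one batch of one packet per timer event (one packet is injected every 10 ms), and is enabled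 at the initial time of the run, so that the first event is $D$ ticks later. *Firewall program.* Its table is a sliding-window Bloom filter with $f\ge 2$ frames, each with $k$ rows of $n\ge1$ bits and one (arbitrary) hash function into $\{0,\dots,n-1\}$ per row. Time is divided into periods of $F=nD$ ticks, number $\lfloor t/F\rfloor$; period $e$ uses frame $e \bmod f$. The parser accepts generated packets (recognized by their ingress port) and IPv4 packets, and rejects all others. On every accepted packet the control block clears the next slot (cyclically) in each row of the frame of the next period. Generated packets are then dropped. An outgoing packet (one arriving on a port of the local network) has its destination address inserted into the frame of the current period, and is forwarded. An incoming packet (one arriving on any other port) is forwarded if some frame other than the one being cleared contains its source address, and dropped otherwise. Routing is an arbitrary function of the destination address. The egress pipeline passes packets on unchanged and does not recirculate. Initially the table is empty. *Correctness.* A flow, with the decisions of the ingress pipeline on its packets, is *correct* if for each packet $p$ in it, at time $t$: (a) if $p$ is an outgoing IPv4 packet, it is forwarded; (b) if $p$ is an incoming IPv4 packet with source $a$ and an earlier packet of the flow is an outgoing IPv4 packet with destination $a$, at a time $t'$ with $t-t'\le (f-2)F$, then $p$ is forwarded; (c) if anything is forwarded for $p$, then either $p$ is an outgoing IPv4 packet,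 or $p$ is an incoming IPv4 packet, with source $a$ say, and there is a period $e$ such that for every row $i$ with hash function $h_i$ the flow contains an earlier outgoing IPv4 packet, at a time $t'$ in period $e$ with $t-t'<(f-1)F$, whose destination $b$ satisfies $h_i(b)=h_i(a)$; where forwarding a packet means sending it unchanged (without the metadata that the switch put in front of it) to the port given by routing. **Theorem.** 1. For all P4 programs, all initial contents of registers and queues, and every configuration whose packet generator injects a packet every 10 ms, the flow of every run of the switch is dense between the initial and the final time of the run. 2. If the firewall's ingress pipeline, started with an empty table, processes a flow whose subsequence of packets accepted by the parser is dense (between some times $t_0$ and $t_1$), then the flow is correct. 3. Consider any run of the switch with the firewall program, an empty mirror configuration, any multicast configuration and a packet generator that injects a packet every 10 ms, started at any time with an empty table, no recirculated packet, empty mirror buffer, egress queues and output, and an arbitrary sequence of received packets. Then the subsequence of packets of the flow accepted by the parser is dense between the initial and the final time of the run, and the flow is correct. Moreover, the packets of the flow that do not come from the packet generator, together with the received packets not yet taken, are exactly the received packets (with multiplicity), and the packets transmitted by the switch are, with multiplicity, among those forwarded in the flow. -/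

import Mathlib

/-! A model of a Tofino switch (one pipeline), its configurable engines, and a stateful firewall. -/

namespace Tofino

/-! ### Bit strings -/

/-- A bit string of width `w`, most significant bit first. -/
abbrev Bits (w : ℕ) := List.Vector Bool w

/-- An unparsed packet: an unstructured sequence of bits. -/
abbrev RawPacket := List Bool

/-- The `w`-bit big-endian representation of `n` (modulo `2 ^ w`). -/
def Bits.ofNat (w n : ℕ) : Bits w :=
  List.Vector.ofFn fun i : Fin w => n.testBit (w - 1 - i)

/-- Switch port numbers are nine bits wide. -/
abbrev Port := Bits 9

/-- Take the first `w` bits off a bit stream; fails if the stream is too short. -/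
def extract (w : ℕ) (p : RawPacket) : Option (Bits w × RawPacket) :=
  if h : w ≤ p.length then some (⟨p.take w, by simp [h]⟩, p.drop w) else none

/-! ### Metadata used by the traffic manager -/

/-- Metadata computed by the ingress control for the traffic manager.  A group field or a port
field that is `none` is not valid. -/
structure TMMeta where
  ucastEgressPort : Option Port := none
  copyToCpu : Bool := false
  mcastGrpA : Option (Bits 16) := none
  mcastGrpB : Option (Bits 16) := none
  rid : Bits 16 := Bits.ofNat 16 0
  level1ExclusionId : Bits 16 := Bits.ofNat 16 0
  level2ExclusionId : Bits 9 := Bits.ofNat 9 0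
  level1Hash : ℕ := 0
  level2Hash : ℕ := 0

/-- Metadata produced by the ingress deparser: whether the packet is marked as dropped. -/
structure DprsrMeta where
  drop : Bool := false

/-- Metadata of a packet between the ingress pipeline and the replication engine. -/
abbrev NormalMeta := TMMeta × DprsrMeta

/-- Metadata attached to each copy of a packet in the egress queues. -/
structure EgressMeta where
  egressPort : Port
  egressRid : Bits 16

/-- Mirror session identifiers; zero means that no mirroring is requested. -/
abbrev MirrorId := Bits 10

/-- Metadata attached by the input ports. -/
abbrev InMeta := List Bool

/-- What bypasses the ingress parser: the time of arrival, and input-port metadata. -/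
abbrev Timestamps := ℤ × InMeta

/-! ### Packet generator (one stream, periodic timer) -/

structure PktGenConfig where
  /-- clock ticks between two timer events -/
  timer : ℕ
  /-- number of batches triggered by one timer event -/
  batches : ℕ
  /-- number of packets in each batch -/
  packetsPerBatch : ℕ
  /-- clock ticks between the starts of consecutive batches of one event -/
  batchGap : ℕ
  /-- clock ticks between consecutive packets of one batch -/
  packetGap : ℕ
  /-- identifier of the stream -/
  appId : ℕ
  /-- contents of the generated packets -/
  buffer : List Bool

/-- The time of the current (or upcoming) timer event, and the indices, within that event, of the
batch and of the packet that are to be generated next. -/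
structure PktGenState where
  eventTime : ℤ
  batch : ℕ
  packet : ℕ

/-- The state of a generator that is enabled at time `t`: the first event is one period later. -/
def PktGenState.enabledAt (c : PktGenConfig) (t : ℤ) : PktGenState := ⟨t + c.timer, 0, 0⟩

/-- The intrinsic metadata that precede every packet entering the ingress parser. -/
structure IntrinsicMeta where
  resubmitFlag : Bits 1
  pad1 : Bits 1
  packetVersion : Bits 2
  pad2 : Bits 3
  ingressPort : Port
  macTstamp : Bits 48

def IntrinsicMeta.encode (h : IntrinsicMeta) : RawPacket :=
  h.resubmitFlag.val ++ h.pad1.val ++ h.packetVersion.val ++ h.pad2.val ++ h.ingressPort.val ++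
    h.macTstamp.val

/-- The header that the packet generator puts in front of the configured buffer. -/
structure PktGenHeader where
  pad1 : Bits 3
  pipeId : Bits 2
  appId : Bits 3
  pad2 : Bits 8
  batchId : Bits 16
  packetId : Bits 16

def PktGenHeader.encode (h : PktGenHeader) : RawPacket :=
  h.pad1.val ++ h.pipeId.val ++ h.appId.val ++ h.pad2.val ++ h.batchId.val ++ h.packetId.val

/-- The port through which generated packets enter the pipeline. -/
def pktGenPort : Port := Bits.ofNat 9 68

/-- The packet generated at time `t` as number `k` of batch `b`: intrinsic metadata, 64 bits of
port metadata, generator header, buffer. -/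
def generatedPacket (c : PktGenConfig) (t : ℤ) (b k : ℕ) : RawPacket :=
  IntrinsicMeta.encode
      { resubmitFlag := Bits.ofNat 1 0, pad1 := Bits.ofNat 1 0, packetVersion := Bits.ofNat 2 0,
        pad2 := Bits.ofNat 3 0, ingressPort := pktGenPort,
        macTstamp := Bits.ofNat 48 t.toNat } ++
    (Bits.ofNat 64 0).val ++
    PktGenHeader.encode
      { pad1 := Bits.ofNat 3 0, pipeId := Bits.ofNat 2 0, appId := Bits.ofNat 3 c.appId,
        pad2 := Bits.ofNat 8 0, batchId := Bits.ofNat 16 b, packetId := Bits.ofNat 16 k } ++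
    c.buffer

/-- When the next packet is due. -/
def PktGenState.due (c : PktGenConfig) (s : PktGenState) : ℤ :=
  s.eventTime + s.batch * c.batchGap + s.packet * c.packetGap

/-- Move on to the next packet, to the next batch, or to the next timer event. -/
def PktGenState.next (c : PktGenConfig) (s : PktGenState) : PktGenState :=
  if s.packet + 1 < c.packetsPerBatch then { s with packet := s.packet + 1 }
  else if s.batch + 1 < c.batches then { s with batch := s.batch + 1, packet := 0 }
  else ⟨s.eventTime + c.timer, 0, 0⟩

/-- The packet generation function, invoked at clock tick `t`. -/
def pktGen (c : PktGenConfig) (t : ℤ) (s : PktGenState) : Option RawPacket × PktGenState :=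
  if c.batches = 0 ∨ c.packetsPerBatch = 0 ∨ t < s.due c then (none, s)
  else (some (generatedPacket c t s.batch s.packet), s.next c)

/-- The packet generator: a recirculated packet is passed on first, otherwise the generation
function is invoked.  In either case the recirculation register is left empty. -/
def PacketGenerator (c : PktGenConfig) (t : ℤ) (sg sg' : PktGenState)
    (precirc precirc' pg : Option RawPacket) : Prop :=
  (sg = sg' ∧ precirc.isSome ∧ pg = precirc ∧ precirc' = none) ∨
  (precirc = none ∧ pktGen c t sg = (pg, sg') ∧ precirc' = none)

/-! ### Input ports -/

/-- Whether a packet entering the ingress pipeline was received by the switch, or comes from the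
packet generator (as a generated or recirculated packet). -/
inductive Source
  | received
  | internal

/-- The input ports forward a packet of the packet generator if there is one, and otherwise any
packet received by the switch, or nothing. -/
def InputPorts (pg : Option RawPacket) (qin qin' : List RawPacket) (_mi : InMeta)
    (src : Source) (pi : Option RawPacket) : Prop :=
  (src = .received ∧ pg = none ∧
    ∃ ql p qr, pi = some p ∧ qin = ql ++ p :: qr ∧ qin' = ql ++ qr) ∨
  (src = .internal ∧ qin' = qin ∧ pi = pg)

/-! ### Mirror session machinery -/

/-- Mirror session tables. -/
abbrev MirrorConfig := List (MirrorId × NormalMeta)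

/-- Specified for the empty table only. -/
def MirrorSessionLookup (c : MirrorConfig) (_i : MirrorId) (m : Option NormalMeta) : Prop :=
  c = [] → m = none

/-- Specified only for an empty buffer and no mirrored packet. -/
def MirrorBufferMerge (mnormal : NormalMeta) (mmirror : Option NormalMeta)
    (qold : List NormalMeta) (mout : NormalMeta) (qnew : List NormalMeta) : Prop :=
  qold = [] ∧ mmirror = none → mout = mnormal ∧ qnew = []

/-! ### Packet replication engine -/

/-- A level-1 node of a multicast group.  `l1Xid = none` means that the exclusion id of the node is
not valid; a LAG is given by the list of its member ports. -/
structure McNode where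
  rid : Bits 16
  l1Xid : Option (Bits 16)
  devPorts : List Port
  lags : List (List Port)

structure McConfig where
  groups : Bits 16 → List McNode
  l2Exclusion : Bits 9 → List Port
  cpuPort : Port

/-- The copies made for one level-1 node: a LAG contributes the member selected by the hash. -/
def McNode.copies (c : McConfig) (m : TMMeta) (n : McNode) : List EgressMeta :=
  if n.l1Xid = some m.level1ExclusionId then []
  else
    ((n.devPorts ++ n.lags.filterMap fun l => l[m.level2Hash % l.length]?).filter
      fun port => ¬ (n.rid = m.rid ∧ port ∈ c.l2Exclusion m.level2ExclusionId)).map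
      fun port => ⟨port, n.rid⟩

def multicastEngine (c : McConfig) (m : NormalMeta) : List EgressMeta :=
  if m.2.drop then []
  else
    (m.1.mcastGrpA.toList ++ m.1.mcastGrpB.toList).flatMap
      (fun g => (c.groups g).flatMap (McNode.copies c m.1)) ++
    (if m.1.copyToCpu then [⟨c.cpuPort, Bits.ofNat 16 0⟩] else [])

def unicastEngine (m : NormalMeta) : Option EgressMeta :=
  if m.2.drop then none
  else m.1.ucastEgressPort.map fun port => ⟨port, Bits.ofNat 16 0⟩

def ReplicationEngine (c : McConfig) (m : NormalMeta) (mrepl : List EgressMeta) : Prop :=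
  mrepl = multicastEngine c m ++ (unicastEngine m).toList

/-! ### Queues and output ports -/

/-- Some of the copies are appended to the egress queue; the others are discarded. -/
def QueueAdmissionControl (mrepl : List EgressMeta) (p : RawPacket)
    (q q' : List (EgressMeta × RawPacket)) : Prop :=
  ∃ ms, List.Sublist ms mrepl ∧ q' = q ++ ms.map fun m => (m, p)

/-- Some queued packet is removed and forwarded. -/
def PacketScheduler (q q' : List (EgressMeta × RawPacket)) (m : EgressMeta) (p : RawPacket) :
    Prop :=
  ∃ ql qr, q = ql ++ (m, p) :: qr ∧ q' = ql ++ qr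

/-- The flag `me` says whether the packet is to be recirculated. -/
def OutputPorts (qout : List RawPacket) (me : Bool) (pe : RawPacket) (qout' : List RawPacket)
    (precirc : Option RawPacket) : Prop :=
  (me = false ∧ qout' = qout ++ [pe] ∧ precirc = none) ∨
  (me = true ∧ qout' = qout ∧ precirc = some pe)

/-! ### P4 programs and the two P4 pipelines -/

/-- The input-output relations of the six P4-programmable components, with the types of their
local states and of the metadata and headers passed between them. -/
structure P4Program where
  (IPState ICState IDState EPState ECState EDState : Type)
  (InHdr InHdrOut EHdr EHdrOut : Type)
  inPrsr : RawPacket → IPState → Option (InHdr × RawPacket) → IPState → Prop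
  inCtrl : Timestamps × InHdr → ICState → TMMeta × MirrorId × InHdrOut → ICState → Prop
  inDprsr : InHdrOut → IDState → DprsrMeta × RawPacket → IDState → Prop
  ePrsr : EgressMeta × RawPacket → EPState → EHdr × RawPacket → EPState → Prop
  eCtrl : EHdr → ECState → EHdrOut → ECState → Prop
  eDprsr : EHdrOut → EDState → Bool × RawPacket → EDState → Prop

/-- Persistent state of the ingress pipeline. -/
abbrev P4Program.IState (P : P4Program) := P.IPState × P.ICState × P.IDState

/-- Persistent state of the egress pipeline. -/
abbrev P4Program.EState (P : P4Program) := P.EPState × P.ECState × P.EDState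

/-- Output of the ingress pipeline; `none` if the parser rejects the packet. -/
abbrev IngressOut := Option ((NormalMeta × MirrorId) × RawPacket)

def IngressPipeline (P : P4Program) (din : Timestamps × RawPacket) (s : P.IState)
    (dout : IngressOut) (s' : P.IState) : Prop :=
  (P.inPrsr din.2 s.1 none s'.1 ∧ s.2 = s'.2 ∧ dout = none) ∨
  ∃ d1 l m2 mmirror d2 m3 h3,
    P.inPrsr din.2 s.1 (some (d1, l)) s'.1 ∧
    P.inCtrl (din.1, d1) s.2.1 (m2, mmirror, d2) s'.2.1 ∧
    P.inDprsr d2 s.2.2 (m3, h3) s'.2.2 ∧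
    dout = some (((m2, m3), mmirror), h3 ++ l)

def EgressPipeline (P : P4Program) (me : EgressMeta) (pe : RawPacket) (s : P.EState)
    (me' : Bool) (pe' : RawPacket) (s' : P.EState) : Prop :=
  ∃ d1 l d2 h3,
    P.ePrsr (me, pe) s.1 (d1, l) s'.1 ∧
    P.eCtrl d1 s.2.1 d2 s'.2.1 ∧
    P.eDprsr d2 s.2.2 (me', h3) s'.2.2 ∧
    pe' = h3 ++ l

/-! ### The whole switch -/

structure SwitchConfig where
  mirror : MirrorConfig
  mc : McConfig
  pktgen : PktGenConfig

structure SwitchState (P : P4Program) where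
  /-- time in clock ticks -/
  t : ℤ
  /-- state of the packet generator -/
  sg : PktGenState
  /-- persistent registers of the ingress pipeline -/
  si : P.IState
  /-- persistent registers of the egress pipeline -/
  se : P.EState
  /-- packets received by the switch and not yet taken by the input ports -/
  qin : List RawPacket
  /-- recirculated packet, if any -/
  precirc : Option RawPacket
  /-- contents of the mirror buffer -/
  qmirror : List NormalMeta
  /-- contents of the output queues -/
  qegress : List (EgressMeta × RawPacket)
  /-- history of packets transmitted by the switch -/
  qout : List RawPacket

/-- A packet entering the ingress pipeline, and what the pipeline makes of it. -/
structure Event where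
  time : ℤ
  source : Source
  packet : RawPacket
  out : IngressOut

/-- One clock tick of the ingress side.  `ev` records the packet entering the ingress pipeline;
it is `none` in a tick in which there is no such packet. -/
def IngressPacket (P : P4Program) (c : SwitchConfig) (σ : SwitchState P) (ev : Option Event)
    (σ' : SwitchState P) : Prop :=
  σ.se = σ'.se ∧ σ.qout = σ'.qout ∧
  ∃ pg mi src pi,
    PacketGenerator c.pktgen σ.t σ.sg σ'.sg σ.precirc σ'.precirc pg ∧ σ'.t = σ.t + 1 ∧
    InputPorts pg σ.qin σ'.qin mi src pi ∧
    match pi with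
    | none => ev = none ∧ σ.si = σ'.si ∧ σ.qmirror = σ'.qmirror ∧ σ.qegress = σ'.qegress
    | some p =>
      (IngressPipeline P ((σ.t, mi), p) σ.si none σ'.si ∧ ev = some ⟨σ.t, src, p, none⟩ ∧
        σ.qmirror = σ'.qmirror ∧ σ.qegress = σ'.qegress) ∨
      ∃ mnormal idmirror p' mmirror mmerge mrepl,
        IngressPipeline P ((σ.t, mi), p) σ.si (some ((mnormal, idmirror), p')) σ'.si ∧
        ev = some ⟨σ.t, src, p, some ((mnormal, idmirror), p')⟩ ∧
        MirrorSessionLookup c.mirror idmirror mmirror ∧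
        MirrorBufferMerge mnormal mmirror σ.qmirror mmerge σ'.qmirror ∧
        ReplicationEngine c.mc mmerge mrepl ∧
        QueueAdmissionControl mrepl p' σ.qegress σ'.qegress

/-- One step of the egress side. -/
def EgressPacket (P : P4Program) (σ σ' : SwitchState P) : Prop :=
  σ.t = σ'.t ∧ σ.sg = σ'.sg ∧ σ.si = σ'.si ∧ σ.qin = σ'.qin ∧ σ.qmirror = σ'.qmirror ∧
  σ.precirc = none ∧
  ∃ me pe me' pe',
    PacketScheduler σ.qegress σ'.qegress me pe ∧
    EgressPipeline P me pe σ.se me' pe' σ'.se ∧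
    OutputPorts σ.qout me' pe' σ'.qout σ'.precirc

/-- Any number of steps of the switch, in any interleaving of its two sides; the list records the
flow of packets entering the ingress pipeline, in order. -/
inductive ProcessPackets (P : P4Program) (c : SwitchConfig) (σ : SwitchState P) :
    List Event → SwitchState P → Prop
  | refl : ProcessPackets P c σ [] σ
  | ingress {tr σ₁ ev σ₂} : ProcessPackets P c σ tr σ₁ → IngressPacket P c σ₁ ev σ₂ →
      ProcessPackets P c σ (tr ++ ev.toList) σ₂
  | egress {tr σ₁ σ₂} : ProcessPackets P c σ tr σ₁ → EgressPacket P σ₁ σ₂ →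
      ProcessPackets P c σ tr σ₂

/-- The ingress pipeline on its own, processing a flow of packets one after the other. -/
inductive PipelineRun (P : P4Program) (s : P.IState) : List Event → P.IState → Prop
  | refl : PipelineRun P s [] s
  | step {tr s₁ mi ev s₂} : PipelineRun P s tr s₁ →
      IngressPipeline P ((ev.time, mi), ev.packet) s₁ ev.out s₂ →
      PipelineRun P s (tr ++ [ev]) s₂

/-! ### Dense flows -/

/-- Between time `t₀` and time `t₁`, the flow is in the order of time and never pauses for more
than `d` ticks: neither before its first packet, nor between two consecutive packets, nor after its
last one. -/
def DenseFlow (d : ℕ) (t₀ t₁ : ℤ) (flow : List Event) : Prop :=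
  List.IsChain (fun a b : ℤ => a ≤ b ∧ b - a ≤ d) (t₀ :: flow.map Event.time ++ [t₁])

/-- The part of a flow that reaches the ingress control, i.e. that the parser accepts. -/
def controlFlow (flow : List Event) : List Event := flow.filter fun e => e.out.isSome

/-- The number of clock ticks in 10 milliseconds. -/
def tenMs (ticksPerMs : ℕ) : ℕ := 10 * ticksPerMs

/-- The generator injects one packet every `d` ticks. -/
def PktGenConfig.InjectsEvery (c : PktGenConfig) (d : ℕ) : Prop :=
  c.timer = d ∧ c.batches = 1 ∧ c.packetsPerBatch = 1

/-! ### The stateful firewall -/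

structure EthernetHeader where
  dst : Bits 48
  src : Bits 48
  etherType : Bits 16

def EthernetHeader.encode (h : EthernetHeader) : RawPacket :=
  h.dst.val ++ h.src.val ++ h.etherType.val

/-- IPv4 addresses. -/
abbrev Addr := Bits 32

structure IPv4Header where
  version : Bits 4
  ihl : Bits 4
  diffserv : Bits 8
  totalLen : Bits 16
  identification : Bits 16
  flags : Bits 3
  fragOffset : Bits 13
  ttl : Bits 8
  protocol : Bits 8
  checksum : Bits 16
  src : Addr
  dst : Addr

def IPv4Header.encode (h : IPv4Header) : RawPacket :=
  h.version.val ++ h.ihl.val ++ h.diffserv.val ++ h.totalLen.val ++ h.identification.val ++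
    h.flags.val ++ h.fragOffset.val ++ h.ttl.val ++ h.protocol.val ++ h.checksum.val ++
    h.src.val ++ h.dst.val

/-- The ether type of IPv4. -/
def etherTypeIPv4 : Bits 16 := Bits.ofNat 16 0x0800

def extractIntrinsicMeta (p : RawPacket) : Option (IntrinsicMeta × RawPacket) := do
  let (a, p) ← extract 1 p
  let (b, p) ← extract 1 p
  let (c, p) ← extract 2 p
  let (d, p) ← extract 3 p
  let (e, p) ← extract 9 p
  let (f, p) ← extract 48 p
  return (⟨a, b, c, d, e, f⟩, p)

def extractPktGenHeader (p : RawPacket) : Option (PktGenHeader × RawPacket) := do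
  let (a, p) ← extract 3 p
  let (b, p) ← extract 2 p
  let (c, p) ← extract 3 p
  let (d, p) ← extract 8 p
  let (e, p) ← extract 16 p
  let (f, p) ← extract 16 p
  return (⟨a, b, c, d, e, f⟩, p)

def extractEthernet (p : RawPacket) : Option (EthernetHeader × RawPacket) := do
  let (a, p) ← extract 48 p
  let (b, p) ← extract 48 p
  let (c, p) ← extract 16 p
  return (⟨a, b, c⟩, p)

def extractIPv4 (p : RawPacket) : Option (IPv4Header × RawPacket) := do
  let (a, p) ← extract 4 p
  let (b, p) ← extract 4 p
  let (c, p) ← extract 8 p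
  let (d, p) ← extract 16 p
  let (e, p) ← extract 16 p
  let (f, p) ← extract 3 p
  let (g, p) ← extract 13 p
  let (h, p) ← extract 8 p
  let (i, p) ← extract 8 p
  let (j, p) ← extract 16 p
  let (k, p) ← extract 32 p
  let (l, p) ← extract 32 p
  return (⟨a, b, c, d, e, f, g, h, i, j, k, l⟩, p)

/-- Headers and metadata produced by the parser of the firewall. -/
inductive FwHeaders
  | generated (m : IntrinsicMeta) (g : PktGenHeader)
  | ipv4 (m : IntrinsicMeta) (eth : EthernetHeader) (ip : IPv4Header)

/-- The parser of the firewall; it rejects what is neither a generated packet nor an IPv4 packet. -/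
def fwParser (p : RawPacket) : Option (FwHeaders × RawPacket) := do
  let (m, p) ← extractIntrinsicMeta p
  let (_, p) ← extract 64 p
  if m.ingressPort = pktGenPort then
    let (g, p) ← extractPktGenHeader p
    return (.generated m g, p)
  else
    let (eth, p) ← extractEthernet p
    if eth.etherType = etherTypeIPv4 then
      let (ip, p) ← extractIPv4 p
      return (.ipv4 m eth ip, p)
    else none

/-- Parameters of the firewall.  Its table is a sliding-window Bloom filter that consists of
`frames` Bloom filters, each with `rows` rows of `slots` bits and one hash function per row. -/
structure Firewall where
  frames : ℕ
  rows : ℕ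
  slots : ℕ
  two_le_frames : 2 ≤ frames
  slots_pos : 0 < slots
  hash : Fin rows → Addr → Fin slots
  /-- the ports that are connected to the local area network -/
  inside : Port → Bool
  /-- the port to which packets with a given destination are sent -/
  route : Addr → Port
  ticksPerMs : ℕ
  ticksPerMs_pos : 0 < ticksPerMs

namespace Firewall

variable (fw : Firewall)

/-- Clearing a frame at the pace of one slot every 10 ms takes this number of ticks; this is the
time during which one frame receives the requests. -/
def frameTicks : ℕ := fw.slots * tenMs fw.ticksPerMs

/-- The number of the time period that contains time `t`. -/
def period (t : ℤ) : ℤ := t / (fw.frameTicks : ℤ)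

/-- Persistent registers: the bits of the frames, and the next slot to be cleared. -/
structure Table where
  bit : ZMod fw.frames → Fin fw.rows → Fin fw.slots → Bool
  clearIdx : Fin fw.slots

def Table.empty : fw.Table where
  bit _ _ _ := false
  clearIdx := ⟨0, fw.slots_pos⟩

variable {fw}

/-- Clear one slot in every row of the frame that will be used in the next period. -/
def Table.clear (s : fw.Table) (t : ℤ) : fw.Table where
  bit f i x :=
    if f = ((fw.period t + 1 : ℤ) : ZMod fw.frames) ∧ x = s.clearIdx then false else s.bit f i x
  clearIdx := ⟨(s.clearIdx + 1) % fw.slots, Nat.mod_lt _ fw.slots_pos⟩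

/-- Insert an address into the frame of the current period. -/
def Table.insert (s : fw.Table) (t : ℤ) (a : Addr) : fw.Table where
  bit f i x :=
    if f = (fw.period t : ZMod fw.frames) ∧ x = fw.hash i a then true else s.bit f i x
  clearIdx := s.clearIdx

/-- Look an address up in all the frames other than the one being cleared. -/
def Table.query (s : fw.Table) (t : ℤ) (a : Addr) : Bool :=
  decide (∃ j : Fin (fw.frames - 1), ∀ i : Fin fw.rows,
    s.bit ((fw.period t - (j : ℤ) : ℤ) : ZMod fw.frames) i (fw.hash i a) = true)

variable (fw)

/-- The control block, run on every packet that the parser accepts.  Besides the new table, it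
computes the metadata for the traffic manager and the drop mark. -/
def control (t : ℤ) (h : FwHeaders) (s : fw.Table) : TMMeta × Bool × fw.Table :=
  match h with
  | .generated _ _ => ({}, true, s.clear t)
  | .ipv4 m _ ip =>
    if fw.inside m.ingressPort then
      ({ ucastEgressPort := some (fw.route ip.dst) }, false, (s.clear t).insert t ip.dst)
    else if (s.clear t).query t ip.src then
      ({ ucastEgressPort := some (fw.route ip.dst) }, false, s.clear t)
    else ({}, true, s.clear t)

/-- The headers that the deparser puts back in front of the payload. -/
def emit : FwHeaders → RawPacket
  | .generated _ g => g.encode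
  | .ipv4 _ eth ip => eth.encode ++ ip.encode

/-- The P4 program of the firewall.  The egress pipeline passes packets on unchanged and never
marks them for recirculation. -/
def program : P4Program where
  IPState := Unit
  ICState := fw.Table
  IDState := Unit
  EPState := Unit
  ECState := Unit
  EDState := Unit
  InHdr := FwHeaders
  InHdrOut := FwHeaders × Bool
  EHdr := Unit
  EHdrOut := Unit
  inPrsr p _ r _ := r = fwParser p
  inCtrl d s r s' := ∃ dr, fw.control d.1.1 d.2 s = (r.1, dr, s') ∧
    r.2.1 = Bits.ofNat 10 0 ∧ r.2.2 = (d.2, dr)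
  inDprsr d _ r _ := r = (⟨d.2⟩, emit d.1)
  ePrsr d _ r _ := r = ((), d.2)
  eCtrl _ _ _ _ := True
  eDprsr _ _ r _ := r = (false, [])

/-- The initial registers of the firewall: an empty table. -/
def initial : fw.program.IState := ((), Table.empty fw, ())

/-! ### Correctness of the firewall -/

/-- `p` is an IPv4 packet that arrived on port `port` (not on the packet generator's port):
intrinsic metadata, 64 bits of port metadata, Ethernet header, IPv4 header, payload. -/
def IsIPv4 (p : RawPacket) (port : Port) (ip : IPv4Header) : Prop :=
  port ≠ pktGenPort ∧
  ∃ (m : IntrinsicMeta) (pm : Bits 64) (eth : EthernetHeader) (l : RawPacket),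
    p = m.encode ++ pm.val ++ eth.encode ++ ip.encode ++ l ∧
    m.ingressPort = port ∧ eth.etherType = etherTypeIPv4

/-- `p` is an outgoing packet: it comes from the local area network. -/
def Outgoing (p : RawPacket) (ip : IPv4Header) : Prop :=
  ∃ port, IsIPv4 p port ip ∧ fw.inside port = true

/-- `p` is an incoming packet: it comes from the internet. -/
def Incoming (p : RawPacket) (ip : IPv4Header) : Prop :=
  ∃ port, IsIPv4 p port ip ∧ fw.inside port = false

/-- `e` is a request to the address `a`. -/
def Request (e : Event) (a : Addr) : Prop := ∃ ip, fw.Outgoing e.packet ip ∧ ip.dst = a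

/-- What the switch received on the wire: the packet without the 128 bits of metadata that the
switch put in front of it. -/
def wire (p : RawPacket) : RawPacket := p.drop 128

/-- The port and the packet to be sent, if the ingress pipeline lets the packet pass. -/
def forwarded (e : Event) : Option (Port × RawPacket) :=
  match e.out with
  | none => none
  | some ((m, _), p) => if m.2.drop then none else m.1.ucastEgressPort.map fun port => (port, p)

/-- The length of the time for which a request is guaranteed to be remembered. -/
def window : ℕ := (fw.frames - 2) * fw.frameTicks

/-- The age at which a request is guaranteed to be forgotten. -/
def maxAge : ℕ := (fw.frames - 1) * fw.frameTicks

/-- The Bloom filter contains `a` at time `t` on account of the requests in `past`, all younger than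
`maxAge`: in one frame, each hash value of `a` is the hash value of a request. -/
def Matches (past : List Event) (t : ℤ) (a : Addr) : Prop :=
  ∃ n : ℤ, ∀ i : Fin fw.rows, ∃ r ∈ past, ∃ b, fw.Request r b ∧
    fw.period r.time = n ∧ t - r.time < fw.maxAge ∧ fw.hash i b = fw.hash i a

/-- Every outgoing packet is forwarded; every incoming packet is forwarded if there was a request
to its source within the window; and nothing else is forwarded, except that an incoming packet may
be forwarded by reason of hash collisions with requests younger than the maximal age.  Packets are
forwarded unchanged. -/
def Correct (flow : List Event) : Prop :=
  ∀ past e future, flow = past ++ e :: future →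
    (∀ ip, fw.Outgoing e.packet ip →
      forwarded e = some (fw.route ip.dst, wire e.packet)) ∧
    (∀ ip, fw.Incoming e.packet ip →
      (∃ r ∈ past, fw.Request r ip.src ∧ e.time - r.time ≤ fw.window) →
      forwarded e = some (fw.route ip.dst, wire e.packet)) ∧
    (∀ port p, forwarded e = some (port, p) →
      p = wire e.packet ∧
      ∃ ip, port = fw.route ip.dst ∧
        (fw.Outgoing e.packet ip ∨
          (fw.Incoming e.packet ip ∧ fw.Matches past e.time ip.src)))

end Firewall

end Tofino

/-!
The flow is dense because the packet generator never lets more than `d` ticks pass in silence: until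
its next timer event is due, at most `d` ticks remain since the last packet, and once the event is
due, every tick brings a packet, either the generated one or a recirculated one that delays it.
This is the invariant `OnSchedule`.  It holds for every part of the flow that retains the generated
and recirculated packets (`OnSchedule.ingressPacket`), in particular for the part that the parser
of the firewall accepts, since that parser accepts the generated packets and the firewall does not
recirculate.

For the Bloom filter, only the sequence of operations caused by the accepted packets matters.  A bit
is set exactly if an operation has set it and none has cleared it since (`Table.after_bit`), and the
`m`-th operation clears slot `m % fw.slots`.  A request within the window survives, because the
frames cleared since then belong to later periods, too few to wrap around
(`Table.query_of_mem`).  Conversely, if a frame in use contained a request from one of its earlier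
turns, then the period just before its latest turn would lie entirely between that request and the
present; density puts at least `fw.slots` consecutive operations into that period
(`exists_index_of_bounded_gaps`), and they clear every slot of the frame (`Table.exists_of_query`).
So a successful query is explained by requests from a single period, hence younger than the maximal
age.

In the switch, the ingress pipeline of the firewall runs on the flow from the empty table, and every
copy that is queued stems from a forwarded packet, since the firewall requests neither multicast
nor, with an empty mirror table, mirroring (`Invariant`).
-/

namespace Tofino

/-! ### Parsing -/

theorem extract_eq_some_iff {w : ℕ} {p l : RawPacket} {v : Bits w} :
    extract w p = some (v, l) ↔ p = v.val ++ l := by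
  unfold extract
  constructor
  · intro h
    split at h
    · simp only [Option.some.injEq] at h
      obtain ⟨rfl, rfl⟩ := h
      simp
    · simp at h
  · rintro rfl
    obtain ⟨v, rfl⟩ := v
    simp

theorem extract_bind_eq_some_iff {α : Type*} {w : ℕ} {p : RawPacket}
    {g : Bits w × RawPacket → Option α} {r : α} :
    (extract w p).bind g = some r ↔ ∃ v l, p = v.val ++ l ∧ g (v, l) = some r := by
  simp only [Option.bind_eq_some_iff, Prod.exists, extract_eq_some_iff]

theorem extractIntrinsicMeta_eq_some_iff {p l : RawPacket} {x : IntrinsicMeta} :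
    extractIntrinsicMeta p = some (x, l) ↔ p = x.encode ++ l := by
  constructor
  · intro h
    iterate 6 obtain ⟨_, _, _, h⟩ := extract_bind_eq_some_iff.1 h
    cases h
    subst_vars
    simp only [IntrinsicMeta.encode, List.append_assoc]
  · rintro rfl
    simp only [IntrinsicMeta.encode, List.append_assoc]
    iterate 6 refine extract_bind_eq_some_iff.2 ⟨_, _, rfl, ?_⟩
    rfl

theorem extractPktGenHeader_eq_some_iff {p l : RawPacket} {x : PktGenHeader} :
    extractPktGenHeader p = some (x, l) ↔ p = x.encode ++ l := by
  constructor
  · intro h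
    iterate 6 obtain ⟨_, _, _, h⟩ := extract_bind_eq_some_iff.1 h
    cases h
    subst_vars
    simp only [PktGenHeader.encode, List.append_assoc]
  · rintro rfl
    simp only [PktGenHeader.encode, List.append_assoc]
    iterate 6 refine extract_bind_eq_some_iff.2 ⟨_, _, rfl, ?_⟩
    rfl

theorem extractEthernet_eq_some_iff {p l : RawPacket} {x : EthernetHeader} :
    extractEthernet p = some (x, l) ↔ p = x.encode ++ l := by
  constructor
  · intro h
    iterate 3 obtain ⟨_, _, _, h⟩ := extract_bind_eq_some_iff.1 h
    cases h
    subst_vars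
    simp only [EthernetHeader.encode, List.append_assoc]
  · rintro rfl
    simp only [EthernetHeader.encode, List.append_assoc]
    iterate 3 refine extract_bind_eq_some_iff.2 ⟨_, _, rfl, ?_⟩
    rfl

theorem extractIPv4_eq_some_iff {p l : RawPacket} {x : IPv4Header} :
    extractIPv4 p = some (x, l) ↔ p = x.encode ++ l := by
  constructor
  · intro h
    iterate 12 obtain ⟨_, _, _, h⟩ := extract_bind_eq_some_iff.1 h
    cases h
    subst_vars
    simp only [IPv4Header.encode, List.append_assoc]
  · rintro rfl
    simp only [IPv4Header.encode, List.append_assoc]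
    iterate 12 refine extract_bind_eq_some_iff.2 ⟨_, _, rfl, ?_⟩
    rfl

theorem fwParser_generatedPacket (c : PktGenConfig) (t : ℤ) (b k : ℕ) :
    (fwParser (generatedPacket c t b k)).isSome := by
  unfold generatedPacket fwParser
  rw [List.append_assoc, List.append_assoc, extractIntrinsicMeta_eq_some_iff.2 rfl]
  simp only [Option.bind_eq_bind, Option.bind_some]
  rw [extract_eq_some_iff.2 rfl]
  simp only [Option.bind_some, if_true]
  rw [extractPktGenHeader_eq_some_iff.2 rfl]
  rfl

theorem fwParser_eq_some_ipv4_iff {p l : RawPacket} {m : IntrinsicMeta} {eth : EthernetHeader}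
    {ip : IPv4Header} :
    fwParser p = some (.ipv4 m eth ip, l) ↔ m.ingressPort ≠ pktGenPort ∧
      eth.etherType = etherTypeIPv4 ∧
      ∃ pm : Bits 64, p = m.encode ++ pm.val ++ eth.encode ++ ip.encode ++ l := by
  constructor
  · intro h
    simp only [fwParser, Option.bind_eq_bind, Option.bind_eq_some_iff, Prod.exists] at h
    obtain ⟨m', p₁, h₁, pm, p₂, h₂, h⟩ := h
    rw [extractIntrinsicMeta_eq_some_iff] at h₁
    rw [extract_eq_some_iff] at h₂
    split at h
    · simp [Option.bind_eq_some_iff] at h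
    · rename_i hport
      simp only [Option.bind_eq_some_iff, Prod.exists] at h
      obtain ⟨eth', p₃, h₃, h⟩ := h
      rw [extractEthernet_eq_some_iff] at h₃
      split at h
      · rename_i heth
        simp only [Option.bind_eq_some_iff, Prod.exists] at h
        obtain ⟨ip', p₄, h₄, h⟩ := h
        rw [extractIPv4_eq_some_iff] at h₄
        cases h
        exact ⟨hport, heth, pm, by simp [h₁, h₂, h₃, h₄]⟩
      · simp at h
  · rintro ⟨hport, heth, pm, rfl⟩
    simp only [List.append_assoc, fwParser]
    rw [extractIntrinsicMeta_eq_some_iff.2 rfl]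
    simp only [Option.bind_eq_bind, Option.bind_some]
    rw [extract_eq_some_iff.2 rfl]
    simp only [Option.bind_some, if_neg hport]
    rw [extractEthernet_eq_some_iff.2 rfl]
    simp only [Option.bind_some, if_pos heth]
    rw [extractIPv4_eq_some_iff.2 rfl]
    rfl

namespace Firewall

variable {fw : Firewall}

theorem isIPv4_iff {p : RawPacket} {port : Port} {ip : IPv4Header} :
    IsIPv4 p port ip ↔
      ∃ m eth l, fwParser p = some (.ipv4 m eth ip, l) ∧ m.ingressPort = port := by
  simp only [IsIPv4, fwParser_eq_some_ipv4_iff]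
  constructor
  · rintro ⟨h, m, pm, eth, l, hp, rfl, he⟩
    exact ⟨m, eth, l, ⟨h, he, pm, hp⟩, rfl⟩
  · rintro ⟨m, eth, l, ⟨h, he, pm, hp⟩, rfl⟩
    exact ⟨h, m, pm, eth, l, hp, rfl, he⟩

theorem wire_of_fwParser {p l : RawPacket} {m : IntrinsicMeta} {eth : EthernetHeader}
    {ip : IPv4Header} (h : fwParser p = some (.ipv4 m eth ip, l)) :
    wire p = eth.encode ++ ip.encode ++ l := by
  obtain ⟨-, -, pm, rfl⟩ := fwParser_eq_some_ipv4_iff.1 h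
  have hlen : (m.encode ++ pm.val).length = 128 := by simp [IntrinsicMeta.encode]
  rw [wire, List.append_assoc, List.append_assoc, ← hlen, List.drop_left, List.append_assoc]

end Firewall
/-! ### Time series with bounded gaps -/

/-- A time series that takes steps of length at most `d` from before the `p`-th interval of length
`n * d` to after it has at least `n` consecutive members in that interval, so the indices of those
members cover all the residues modulo `n`. -/
theorem exists_index_of_bounded_gaps {u : ℕ → ℤ} (hu : Monotone u) {d n : ℕ} (hd : 0 < d)
    (hgap : ∀ k, u (k + 1) ≤ u k + d) {p : ℤ} {k M : ℕ}
    (hk : u k / ((n * d : ℕ) : ℤ) < p) (hM : p < u M / ((n * d : ℕ) : ℤ)) {x : ℕ} (hx : x < n) :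
    ∃ m, k < m ∧ m < M ∧ u m / ((n * d : ℕ) : ℤ) = p ∧ m % n = x := by
  have hF : (0 : ℤ) < ((n * d : ℕ) : ℤ) := by
    exact_mod_cast Nat.mul_pos (by omega) hd
  have hk' : u k < p * ((n * d : ℕ) : ℤ) := (Int.ediv_lt_iff_lt_mul hF).1 hk
  have hM' : (p + 1) * ((n * d : ℕ) : ℤ) ≤ u M := (Int.le_ediv_iff_mul_le hF).1 hM
  have hex : ∃ j, p * ((n * d : ℕ) : ℤ) ≤ u j := ⟨M, by nlinarith⟩
  classical
  -- The first member of the series in the interval is less than `d` after its start.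
  obtain ⟨a, ha⟩ : ∃ a, Nat.find hex = a + 1 := by
    refine Nat.exists_eq_succ_of_ne_zero fun h0 => ?_
    have := Nat.find_spec hex
    rw [h0] at this
    have := hu (Nat.zero_le k)
    omega
  have hstart : p * ((n * d : ℕ) : ℤ) ≤ u (a + 1) := ha ▸ Nat.find_spec hex
  have hbefore : u a < p * ((n * d : ℕ) : ℤ) :=
    not_le.1 (Nat.find_min hex (show a < Nat.find hex by omega))
  have hka : k < a + 1 := by
    by_contra h
    have := hu (not_lt.1 h)
    omega
  have hstep : ∀ i : ℕ, u (a + 1 + i) < p * ((n * d : ℕ) : ℤ) + (i + 1) * d := by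
    intro i
    induction i with
    | zero => have := hgap a; push_cast at *; linarith
    | succ i ih => have := hgap (a + 1 + i); push_cast at *; rw [← add_assoc]; linarith
  -- Among the `n` consecutive indices from `a + 1` on, one is congruent to `x`.
  obtain ⟨i, hi, hix⟩ : ∃ i < n, (a + 1 + i) % n = x := by
    refine ⟨(x + (n - (a + 1) % n)) % n, Nat.mod_lt _ (by omega), ?_⟩
    have hlt := Nat.mod_lt (a + 1) (show 0 < n by omega)
    rw [Nat.add_mod_mod, ← Nat.mod_add_mod,
      show (a + 1) % n + (x + (n - (a + 1) % n)) = x + n by omega, Nat.add_mod_right,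
      Nat.mod_eq_of_lt hx]
  have hend : u (a + 1 + i) < (p + 1) * ((n * d : ℕ) : ℤ) := by
    refine (hstep i).trans_le ?_
    have : ((i : ℤ) + 1) * d ≤ n * d := by
      have : (i : ℤ) + 1 ≤ n := by exact_mod_cast hi
      gcongr
    push_cast
    linarith
  have hlow : p * ((n * d : ℕ) : ℤ) ≤ u (a + 1 + i) := hstart.trans (hu (by omega))
  refine ⟨a + 1 + i, by omega, ?_, ?_, hix⟩
  · by_contra h
    have := hu (not_lt.1 h)
    omega
  · exact le_antisymm (Int.lt_add_one_iff.1 ((Int.ediv_lt_iff_lt_mul hF).2 hend))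
      ((Int.le_ediv_iff_mul_le hF).2 hlow)

/-! ### The sliding-window Bloom filter -/

namespace Firewall

variable {fw : Firewall}

theorem tenMs_pos : 0 < tenMs fw.ticksPerMs :=
  Nat.mul_pos (by norm_num) fw.ticksPerMs_pos

theorem frameTicks_pos : (0 : ℤ) < fw.frameTicks := by
  exact_mod_cast Nat.mul_pos fw.slots_pos tenMs_pos

/-- The effect on the table of a packet accepted at time `o.1`: one slot is cleared, and the
address `o.2`, if any, is inserted. -/
def Table.apply (s : fw.Table) (o : ℤ × Option Addr) : fw.Table :=
  match o.2 with
  | none => s.clear o.1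
  | some a => (s.clear o.1).insert o.1 a

/-- The table that results from the empty table by a sequence of operations. -/
def Table.after (fw : Firewall) (ops : List (ℤ × Option Addr)) : fw.Table :=
  ops.foldl Table.apply (Table.empty fw)

theorem Table.after_append_singleton (ops : List (ℤ × Option Addr)) (o : ℤ × Option Addr) :
    Table.after fw (ops ++ [o]) = (Table.after fw ops).apply o := by
  simp [Table.after]

theorem Table.apply_bit (s : fw.Table) (o : ℤ × Option Addr) (f : ZMod fw.frames)
    (i : Fin fw.rows) (x : Fin fw.slots) :
    (s.apply o).bit f i x = true ↔
      (∃ b, o.2 = some b ∧ (fw.period o.1 : ZMod fw.frames) = f ∧ fw.hash i b = x) ∨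
      (s.bit f i x = true ∧
        ¬ (f = ((fw.period o.1 + 1 : ℤ) : ZMod fw.frames) ∧ x = s.clearIdx)) := by
  obtain ⟨t, _ | a⟩ := o
  · simp [Table.apply, Table.clear]
    tauto
  · simp only [Table.apply, Table.clear, Table.insert, Option.some.injEq, exists_eq_left']
    split_ifs with h₁ h₂
    · simp [h₁.1, h₁.2]
    · simp only [h₂, and_self, not_true_eq_false, and_false, or_false,
        false_iff]
      rw [h₂.1, h₂.2] at h₁
      exact fun h => h₁ ⟨h.1.symm, h.2.symm⟩
    · constructor
      · exact fun h => .inr ⟨h, h₂⟩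
      · rintro (h | h)
        · exact absurd ⟨h.1.symm, h.2.symm⟩ h₁
        · exact h.1

theorem Table.after_clearIdx (ops : List (ℤ × Option Addr)) :
    ((Table.after fw ops).clearIdx : ℕ) = ops.length % fw.slots := by
  induction ops using List.reverseRecOn with
  | nil => simp [Table.after, Table.empty]
  | append_singleton ops o ih =>
    obtain ⟨t, _ | a⟩ := o <;>
      simp [Table.after_append_singleton, Table.apply, Table.clear, Table.insert, ih]

/-- A bit is set exactly if some operation has set it and no later operation has cleared it.  The
`m`-th operation clears slot `m % fw.slots`. -/
theorem Table.after_bit (ops : List (ℤ × Option Addr)) (f : ZMod fw.frames)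
    (i : Fin fw.rows) (x : Fin fw.slots) :
    (Table.after fw ops).bit f i x = true ↔
      ∃ (k : ℕ) (t : ℤ) (b : Addr), ops[k]? = some (t, some b) ∧
        (fw.period t : ZMod fw.frames) = f ∧ fw.hash i b = x ∧
        ∀ m o, k < m → ops[m]? = some o →
          ¬ (f = ((fw.period o.1 + 1 : ℤ) : ZMod fw.frames) ∧ (x : ℕ) = m % fw.slots) := by
  induction ops using List.reverseRecOn with
  | nil => simp [Table.after, Table.empty]
  | append_singleton ops o ih =>
    rw [Table.after_append_singleton, Table.apply_bit, ih, Fin.ext_iff, Table.after_clearIdx]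
    constructor
    · rintro (⟨b, hb, hf, hx⟩ | ⟨⟨k, t, b, hk, hf, hx, hlater⟩, hlast⟩)
      · refine ⟨ops.length, o.1, b, by simp [← hb], hf, hx, fun m o' hm ho' => ?_⟩
        rw [List.getElem?_eq_none (by simp; omega)] at ho'
        cases ho'
      · have hkl : k < ops.length := (List.getElem?_eq_some_iff.1 hk).1
        refine ⟨k, t, b, by rwa [List.getElem?_append_left hkl], hf, hx, fun m o' hm ho' => ?_⟩
        rcases lt_trichotomy m ops.length with h | rfl | h
        · exact hlater m o' hm (by rwa [List.getElem?_append_left h] at ho')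
        · obtain rfl : o = o' := by simpa using ho'
          exact hlast
        · rw [List.getElem?_eq_none (by simp; omega)] at ho'
          cases ho'
    · rintro ⟨k, t, b, hk, hf, hx, hlater⟩
      rcases lt_trichotomy k ops.length with h | rfl | h
      · rw [List.getElem?_append_left h] at hk
        refine .inr ⟨⟨k, t, b, hk, hf, hx, fun m o' hm ho' => ?_⟩, ?_⟩
        · have hml : m < ops.length := (List.getElem?_eq_some_iff.1 ho').1
          exact hlater m o' hm (by rwa [List.getElem?_append_left hml])
        · exact hlater ops.length o h (by simp)
      · obtain rfl : o = (t, some b) := by simpa using hk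
        exact .inl ⟨b, rfl, hf, hx⟩
      · rw [List.getElem?_eq_none (by simp; omega)] at hk
        cases hk

theorem intCast_frames_eq_iff {a b : ℤ} :
    (a : ZMod fw.frames) = b ↔ (fw.frames : ℤ) ∣ b - a :=
  ZMod.intCast_eq_intCast_iff_dvd_sub a b fw.frames

theorem eq_of_frames_dvd_sub {a b : ℤ} (h : (fw.frames : ℤ) ∣ b - a)
    (h₁ : b - a < fw.frames) (h₂ : a - b < fw.frames) : a = b := by
  have := Int.eq_zero_of_abs_lt_dvd h (abs_lt.2 ⟨by omega, h₁⟩)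
  omega

/-- The frames that are looked up do not include the one that is being cleared. -/
theorem Table.clear_query (s : fw.Table) (t : ℤ) (a : Addr) :
    (s.clear t).query t a = s.query t a := by
  unfold Table.query
  congr! 4 with j i
  have hne : ((fw.period t - (j : ℤ) : ℤ) : ZMod fw.frames) ≠
      ((fw.period t + 1 : ℤ) : ZMod fw.frames) := by
    rw [Ne, intCast_frames_eq_iff]
    intro h
    have := eq_of_frames_dvd_sub h (by omega) (by omega)
    omega
  simp only [Table.clear, hne, false_and, if_false]

/-- The times of a sequence of operations, continued by the constant `t`. -/
def opTime (ops : List (ℤ × Option Addr)) (t : ℤ) (k : ℕ) : ℤ :=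
  (ops[k]?.map Prod.fst).getD t

theorem opTime_of_getElem? {ops : List (ℤ × Option Addr)} {t : ℤ} {k : ℕ} {o : ℤ × Option Addr}
    (h : ops[k]? = some o) : opTime ops t k = o.1 := by
  simp [opTime, h]

theorem opTime_length (ops : List (ℤ × Option Addr)) (t : ℤ) : opTime ops t ops.length = t := by
  simp [opTime]

theorem opTime_step {ops : List (ℤ × Option Addr)} {t : ℤ} {d : ℕ}
    (h : List.IsChain (fun a b : ℤ => a ≤ b ∧ b - a ≤ d) (ops.map Prod.fst ++ [t])) (k : ℕ) :
    opTime ops t k ≤ opTime ops t (k + 1) ∧ opTime ops t (k + 1) ≤ opTime ops t k + d := by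
  have key : ∀ j, j ≤ ops.length → (ops.map Prod.fst ++ [t])[j]? = some (opTime ops t j) := by
    intro j hj
    rcases hj.lt_or_eq with h | rfl
    · rw [List.getElem?_append_left (by simpa using h)]
      simp [opTime, h]
    · rw [opTime_length, List.getElem?_append_right (by simp)]
      simp
  rcases Nat.lt_or_ge k ops.length with hk | hk
  · have := List.isChain_iff_getElem.1 h k (by simp; omega)
    obtain ⟨h₁, e₁⟩ := List.getElem?_eq_some_iff.1 (key k hk.le)
    obtain ⟨h₂, e₂⟩ := List.getElem?_eq_some_iff.1 (key (k + 1) hk)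
    rw [e₁, e₂] at this
    omega
  · have e₁ : opTime ops t k = t := by simp [opTime, hk]
    have e₂ : opTime ops t (k + 1) = t := by simp [opTime, show ops.length ≤ k + 1 by omega]
    omega

theorem opTime_monotone {ops : List (ℤ × Option Addr)} {t : ℤ} {d : ℕ}
    (h : List.IsChain (fun a b : ℤ => a ≤ b ∧ b - a ≤ d) (ops.map Prod.fst ++ [t])) :
    Monotone (opTime ops t) :=
  monotone_nat_of_le_succ fun k => (opTime_step h k).1

theorem period_mono {t t' : ℤ} (h : t ≤ t') : fw.period t ≤ fw.period t' :=
  Int.ediv_le_ediv frameTicks_pos h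

theorem two_le_frames_int : (2 : ℤ) ≤ fw.frames := by exact_mod_cast fw.two_le_frames

/-- A request no older than the window is still in the table: in the meantime, only frames of later
periods have been cleared, and those are too few to wrap around to the frame of the request. -/
theorem Table.query_of_mem {ops : List (ℤ × Option Addr)} {t : ℤ}
    (hd : List.IsChain (fun a b : ℤ => a ≤ b ∧ b - a ≤ tenMs fw.ticksPerMs)
      (ops.map Prod.fst ++ [t]))
    {t' : ℤ} {a : Addr} (hmem : (t', some a) ∈ ops) (hw : t - t' ≤ fw.window) :
    (Table.after fw ops).query t a = true := by
  have hmono := opTime_monotone hd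
  obtain ⟨k, hk⟩ := List.getElem?_of_mem hmem
  have hkl : k < ops.length := (List.getElem?_eq_some_iff.1 hk).1
  have hF := frameTicks_pos (fw := fw)
  have h2 := two_le_frames_int (fw := fw)
  have hle : ∀ m o, k ≤ m → ops[m]? = some o →
      fw.period t' ≤ fw.period o.1 ∧ fw.period o.1 ≤ fw.period t := by
    intro m o hm ho
    have hml : m < ops.length := (List.getElem?_eq_some_iff.1 ho).1
    rw [← opTime_of_getElem? (t := t) ho]
    constructor
    · rw [show t' = opTime ops t k from (opTime_of_getElem? hk).symm]
      exact period_mono (hmono hm)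
    · conv_rhs => rw [← opTime_length ops t]
      exact period_mono (hmono hml.le)
  have hpt : fw.period t' ≤ fw.period t := (hle k _ le_rfl hk).2
  -- Going back in time by `frames - 2` periods decreases the period number by as much.
  have hspan : fw.period t - ((fw.frames : ℤ) - 2) ≤ fw.period t' := by
    have hw' : (fw.window : ℤ) = ((fw.frames : ℤ) - 2) * fw.frameTicks := by
      rw [window, Nat.cast_mul, Nat.cast_sub fw.two_le_frames]; rfl
    have : t + -((fw.frames : ℤ) - 2) * fw.frameTicks ≤ t' := by linarith
    have := period_mono (fw := fw) this
    rw [period, Int.add_mul_ediv_right _ _ hF.ne'] at this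
    rw [period]
    linarith
  simp only [Table.query, decide_eq_true_eq]
  refine ⟨⟨(fw.period t - fw.period t').toNat, by omega⟩, fun i => ?_⟩
  have hj : fw.period t - (((fw.period t - fw.period t').toNat : ℕ) : ℤ) = fw.period t' := by omega
  simp only [hj]
  rw [Table.after_bit]
  refine ⟨k, t', a, hk, rfl, rfl, fun m o hm ho hcl => ?_⟩
  have ho' := hle m o hm.le ho
  have := eq_of_frames_dvd_sub (intCast_frames_eq_iff.1 hcl.1) (by omega) (by omega)
  omega

/-- A frame that is looked up contains only the requests of its latest period: those of an earlier
period with the same frame have been cleared in the period before, which is complete. -/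
theorem Table.exists_of_query {ops : List (ℤ × Option Addr)} {t : ℤ}
    (hd : List.IsChain (fun a b : ℤ => a ≤ b ∧ b - a ≤ tenMs fw.ticksPerMs)
      (ops.map Prod.fst ++ [t]))
    {a : Addr} (hq : (Table.after fw ops).query t a = true) :
    ∃ n : ℤ, ∀ i : Fin fw.rows, ∃ t' b, (t', some b) ∈ ops ∧ fw.period t' = n ∧
      t - t' < fw.maxAge ∧ fw.hash i b = fw.hash i a := by
  have hmono := opTime_monotone hd
  have hF := frameTicks_pos (fw := fw)
  simp only [Table.query, decide_eq_true_eq] at hq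
  obtain ⟨j, hj⟩ := hq
  refine ⟨fw.period t - j, fun i => ?_⟩
  obtain ⟨k, t', b, hk, hf, hx, hlater⟩ := (Table.after_bit ops _ _ _).1 (hj i)
  have hkl : k < ops.length := (List.getElem?_eq_some_iff.1 hk).1
  have hkt : opTime ops t k = t' := opTime_of_getElem? hk
  have hpt : fw.period t' ≤ fw.period t := by
    rw [← hkt]
    conv_rhs => rw [← opTime_length ops t]
    exact period_mono (hmono hkl.le)
  have hn : fw.period t' = fw.period t - j := by
    by_contra hne
    have hdvd := intCast_frames_eq_iff.1 hf
    have hlt : fw.period t' < fw.period t - j - 1 := by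
      by_contra h
      have h2 := two_le_frames_int (fw := fw)
      exact hne (eq_of_frames_dvd_sub hdvd (by omega) (by omega))
    -- Period `fw.period t - j - 1` lies strictly between that of the request and the current one, so
    -- it is complete, and the slot `fw.hash i a` was cleared in it.
    obtain ⟨m, hkm, hml, hmp, hmx⟩ := exists_index_of_bounded_gaps (n := fw.slots) (k := k)
      (M := ops.length) (p := fw.period t - j - 1) hmono tenMs_pos
      (fun k => (opTime_step hd k).2) (by rw [hkt]; exact hlt)
      (by rw [opTime_length]; change _ < fw.period t; omega) (fw.hash i a).isLt
    refine hlater m ops[m] hkm (List.getElem?_eq_getElem hml) ⟨?_, hmx.symm⟩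
    rw [opTime_of_getElem? (List.getElem?_eq_getElem hml)] at hmp
    change fw.period _ = _ at hmp
    rw [hmp, sub_add_cancel]
  refine ⟨t', b, List.mem_of_getElem? hk, hn, ?_, hx⟩
  have h₁ : fw.period t' * fw.frameTicks ≤ t' := Int.ediv_mul_le _ hF.ne'
  have h₂ : t < (fw.period t + 1) * fw.frameTicks := Int.lt_ediv_add_one_mul_self _ hF
  have h₃ : (fw.maxAge : ℤ) = ((fw.frames : ℤ) - 1) * fw.frameTicks := by
    rw [maxAge, Nat.cast_mul, Nat.cast_sub (one_le_two.trans fw.two_le_frames)]; rfl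
  have h₄ : (j : ℤ) + 2 ≤ fw.frames := by have := j.isLt; omega
  rw [hn] at h₁
  rw [h₃]
  nlinarith

end Firewall
/-! ### The ingress pipeline of the firewall -/

namespace Firewall

variable {fw : Firewall}

variable (fw) in
/-- The address that the control block inserts into the table. -/
def requested : FwHeaders → Option Addr
  | .generated _ _ => none
  | .ipv4 m _ ip => if fw.inside m.ingressPort then some ip.dst else none

variable (fw) in
/-- The operation on the table that a packet causes; `none` if the parser rejects the packet. -/
def op (e : Event) : Option (ℤ × Option Addr) :=
  (fwParser e.packet).map fun r => (e.time, fw.requested r.1)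

variable (fw) in
/-- The output of the ingress pipeline as a function of the table and the packet. -/
def verdict (s : fw.Table) (t : ℤ) (p : RawPacket) : IngressOut :=
  (fwParser p).map fun r =>
    ((((fw.control t r.1 s).1, ⟨(fw.control t r.1 s).2.1⟩), Bits.ofNat 10 0), emit r.1 ++ r.2)

theorem control_table (t : ℤ) (h : FwHeaders) (s : fw.Table) :
    (fw.control t h s).2.2 = s.apply (t, fw.requested h) := by
  obtain _ | ⟨m, eth, ip⟩ := h
  · rfl
  · simp only [control, requested]
    split_ifs <;> rfl

/-- The table, as part of the persistent state of the ingress pipeline. -/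
def table (s : fw.program.IState) : fw.Table := s.2.1

theorem ingressPipeline_program {t : ℤ} {mi : InMeta} {p : RawPacket} {s s' : fw.program.IState}
    {out : IngressOut} (h : IngressPipeline fw.program ((t, mi), p) s out s') :
    out = fw.verdict (table s) t p ∧
      table s' =
        ((fwParser p).map fun r => (t, fw.requested r.1)).elim (table s) (table s).apply := by
  rcases h with ⟨h, hs, rfl⟩ |
    ⟨(d1 : FwHeaders), l, (m2 : TMMeta), mm, (d2 : FwHeaders × Bool), m3, h3, h, hc, hd, rfl⟩
  · replace h : none = fwParser p := h
    rw [verdict, ← h]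
    exact ⟨rfl, congrArg Prod.fst hs.symm⟩
  · replace h : some (d1, l) = fwParser p := h
    obtain ⟨dr, hc, hm, hd2⟩ := hc
    replace hc : fw.control t d1 (table s) = (m2, dr, table s') := hc
    replace hm : mm = Bits.ofNat 10 0 := hm
    replace hd2 : d2 = (d1, dr) := hd2
    replace hd : (m3, h3) = (⟨d2.2⟩, emit d2.1) := hd
    obtain ⟨rfl, rfl⟩ := Prod.mk.inj hd
    subst hm hd2
    rw [verdict, ← h, Option.map_some, Option.map_some, Option.elim_some]
    have htab := control_table t d1 (table s)
    rw [hc] at htab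
    refine ⟨?_, htab⟩
    dsimp only
    rw [hc]

theorem pipelineRun_program {flow : List Event} {s' : fw.program.IState}
    (h : PipelineRun fw.program fw.initial flow s') :
    table s' = Table.after fw (flow.filterMap fw.op) ∧
      ∀ past e future, flow = past ++ e :: future →
        e.out = fw.verdict (Table.after fw (past.filterMap fw.op)) e.time e.packet := by
  induction h with
  | refl => exact ⟨rfl, by simp⟩
  | @step tr s₁ mi ev s₂ _ hstep ih =>
    obtain ⟨hout, htab⟩ := ingressPipeline_program hstep
    obtain ⟨ih₁, ih₂⟩ := ih
    rw [ih₁] at hout htab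
    constructor
    · rw [htab, List.filterMap_append]
      change (fw.op ev).elim _ _ = _
      rcases hop : fw.op ev with _ | o
      · simp [List.filterMap, hop]
      · simp [List.filterMap, hop, Table.after_append_singleton]
    · intro past e future hsplit
      rcases List.eq_nil_or_concat' future with rfl | ⟨future, e', rfl⟩
      · obtain ⟨rfl, he⟩ := List.append_inj' hsplit rfl
        cases he
        exact hout
      · rw [← List.cons_append, ← List.append_assoc] at hsplit
        exact ih₂ past e future (List.append_inj' hsplit rfl).1

theorem request_iff {e : Event} {a : Addr} : fw.Request e a ↔ fw.op e = some (e.time, some a) := by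
  simp only [Request, Outgoing, isIPv4_iff, op]
  constructor
  · rintro ⟨ip, ⟨port, ⟨m, eth, l, hp, rfl⟩, hin⟩, rfl⟩
    simp [hp, requested, hin]
  · intro h
    obtain ⟨⟨hd, l⟩, hp, h⟩ := Option.map_eq_some_iff.1 h
    obtain _ | ⟨m, eth, ip⟩ := hd
    · simp [requested] at h
    · simp only [requested, Prod.mk.injEq, true_and] at h
      split_ifs at h with hin
      exact ⟨ip, ⟨_, ⟨m, eth, l, hp, rfl⟩, hin⟩, by simpa using h⟩

theorem mem_filterMap_op_iff {l : List Event} {t : ℤ} {a : Addr} :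
    (t, some a) ∈ l.filterMap fw.op ↔ ∃ r ∈ l, fw.Request r a ∧ r.time = t := by
  simp only [List.mem_filterMap, request_iff]
  refine exists_congr fun r => and_congr_right fun _ => ⟨fun h => ?_, ?_⟩
  · obtain ⟨_, -, h'⟩ := Option.map_eq_some_iff.1 h
    obtain rfl := congrArg Prod.fst h'
    exact ⟨h, rfl⟩
  · rintro ⟨h, rfl⟩
    exact h

theorem map_fst_filterMap_op {l : List Event} (h : ∀ e ∈ l, e.out.isSome = (fw.op e).isSome) :
    (l.filterMap fw.op).map Prod.fst = (controlFlow l).map Event.time := by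
  induction l with
  | nil => rfl
  | cons e l ih =>
    obtain ⟨he, hl⟩ := List.forall_mem_cons.1 h
    specialize ih hl
    simp only [controlFlow, List.filter_cons, List.filterMap_cons] at ih ⊢
    rcases hop : fw.op e with _ | o
    · simpa [he, hop] using ih
    · obtain ⟨_, -, rfl⟩ := Option.map_eq_some_iff.1 hop
      simpa [he, hop] using ih

theorem verdict_isSome (s : fw.Table) (e : Event) :
    (fw.verdict s e.time e.packet).isSome = (fw.op e).isSome := by
  simp [verdict, op]

theorem forwarded_of_parse {e : Event} {s : fw.Table} {r : FwHeaders × RawPacket}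
    (hout : e.out = fw.verdict s e.time e.packet) (hp : fwParser e.packet = some r) :
    forwarded e = if (fw.control e.time r.1 s).2.1 then none
      else (fw.control e.time r.1 s).1.ucastEgressPort.map fun port => (port, emit r.1 ++ r.2) := by
  simp [forwarded, hout, verdict, hp]

theorem correct_of_dense {s' : fw.program.IState} {t₀ t₁ : ℤ} {flow : List Event}
    (hrun : PipelineRun fw.program fw.initial flow s')
    (hdense : DenseFlow (tenMs fw.ticksPerMs) t₀ t₁ (controlFlow flow)) : fw.Correct flow := by
  obtain ⟨-, hout⟩ := pipelineRun_program hrun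
  have hsome : ∀ e ∈ flow, e.out.isSome = (fw.op e).isSome := by
    intro e he
    obtain ⟨past, future, hsplit⟩ := List.append_of_mem he
    rw [hout past e future hsplit, verdict_isSome]
  intro past e future hsplit
  have hout := hout past e future hsplit
  simp only [Outgoing, Incoming, isIPv4_iff]
  rcases hp : fwParser e.packet with _ | ⟨hd, l⟩
  · simp [forwarded, hout, verdict, hp]
  have hfwd := forwarded_of_parse hout hp
  obtain _ | ⟨m, eth, ip⟩ := hd
  · simp [hfwd, control]
  have hwire : emit (.ipv4 m eth ip) ++ l = wire e.packet := (wire_of_fwParser hp).symm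
  have hd : List.IsChain (fun a b : ℤ => a ≤ b ∧ b - a ≤ tenMs fw.ticksPerMs)
      ((past.filterMap fw.op).map Prod.fst ++ [e.time]) := by
    rw [DenseFlow, ← map_fst_filterMap_op hsome, hsplit] at hdense
    refine hdense.infix ⟨[t₀], (future.filterMap fw.op).map Prod.fst ++ [t₁], ?_⟩
    simp [op, hp]
  simp only [hwire] at hfwd
  simp only [Option.some.injEq, Prod.mk.injEq, FwHeaders.ipv4.injEq]
  by_cases hin : fw.inside m.ingressPort = true
  · have hfwd' : forwarded e = some (fw.route ip.dst, wire e.packet) := by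
      simp [hfwd, control, hin]
    rw [hfwd']
    refine ⟨?_, ?_, ?_⟩
    · rintro _ ⟨_, ⟨_, _, _, ⟨⟨rfl, rfl, rfl⟩, rfl⟩, rfl⟩, -⟩
      rfl
    · rintro _ ⟨_, ⟨_, _, _, ⟨⟨rfl, rfl, rfl⟩, rfl⟩, rfl⟩, -⟩ -
      rfl
    · intro port p h
      obtain ⟨rfl, rfl⟩ := Prod.mk.inj (Option.some.inj h)
      exact ⟨rfl, ip, rfl, .inl ⟨_, ⟨m, eth, l, ⟨⟨rfl, rfl, rfl⟩, rfl⟩, rfl⟩, hin⟩⟩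
  · have hfwd' : forwarded e =
        if (Table.after fw (past.filterMap fw.op)).query e.time ip.src = true then
          some (fw.route ip.dst, wire e.packet) else none := by
      rw [hfwd]
      simp only [control, hin, Table.clear_query]
      split_ifs <;> simp_all
    rw [hfwd']
    refine ⟨?_, ?_, ?_⟩
    · rintro _ ⟨_, ⟨_, _, _, ⟨⟨rfl, rfl, rfl⟩, rfl⟩, rfl⟩, h⟩
      exact absurd h hin
    · rintro _ ⟨_, ⟨_, _, _, ⟨⟨rfl, rfl, rfl⟩, rfl⟩, rfl⟩, -⟩ ⟨r, hr, hreq, hw⟩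
      rw [if_pos (Table.query_of_mem hd (mem_filterMap_op_iff.2 ⟨r, hr, hreq, rfl⟩) hw)]
    · intro port p h
      split_ifs at h with hq
      obtain ⟨rfl, rfl⟩ := Prod.mk.inj (Option.some.inj h)
      refine ⟨rfl, ip, rfl, .inr ⟨⟨_, ⟨m, eth, l, ⟨⟨rfl, rfl, rfl⟩, rfl⟩, rfl⟩,
        by simpa using hin⟩, ?_⟩⟩
      obtain ⟨n, hn⟩ := Table.exists_of_query hd hq
      refine ⟨n, fun i => ?_⟩
      obtain ⟨t', b, hmem, hper, hage, hhash⟩ := hn i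
      obtain ⟨r, hr, hreq, rfl⟩ := mem_filterMap_op_iff.1 hmem
      exact ⟨r, hr, b, hreq, hper, hage, hhash⟩

end Firewall
/-! ### The packet generator -/

theorem DenseFlow.append_singleton {d : ℕ} {t₀ t t₁ : ℤ} {flow : List Event} {e : Event}
    (h : DenseFlow d t₀ t flow) (he : e.time = t) (h₁ : t ≤ t₁) (h₂ : t₁ - t ≤ d) :
    DenseFlow d t₀ t₁ (flow ++ [e]) := by
  unfold DenseFlow at *
  rw [List.map_append, List.map_singleton, he, ← List.cons_append]
  refine h.append (List.isChain_singleton _) fun x hx y hy => ?_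
  rw [List.getLast?_concat] at hx
  cases hx
  cases hy
  exact ⟨h₁, h₂⟩

/-- At time `t`, the generator in state `s` is on schedule with respect to the flow so far: the flow
remains dense if nothing is added to it until the next timer event, which is at most `d` ticks
away (and which is in the past if recirculated packets have delayed it). -/
structure OnSchedule (d : ℕ) (t₀ t : ℤ) (s : PktGenState) (flow : List Event) : Prop where
  batch : s.batch = 0
  packet : s.packet = 0
  eventTime_le : s.eventTime ≤ t + d
  dense : ∀ t₁, t ≤ t₁ → t₁ ≤ max t s.eventTime → DenseFlow d t₀ t₁ flow

theorem OnSchedule.enabledAt {c : PktGenConfig} {d : ℕ} (hc : c.InjectsEvery d) (t : ℤ) :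
    OnSchedule d t t (.enabledAt c t) [] where
  batch := rfl
  packet := rfl
  eventTime_le := by simp [PktGenState.enabledAt, hc.1]
  dense t₁ h₁ h₂ := by
    simp only [PktGenState.enabledAt, hc.1] at h₂
    simp [DenseFlow]
    omega

theorem OnSchedule.idle {d : ℕ} {t₀ t : ℤ} {s : PktGenState} {flow : List Event}
    (h : OnSchedule d t₀ t s flow) (ht : t < s.eventTime) : OnSchedule d t₀ (t + 1) s flow where
  batch := h.batch
  packet := h.packet
  eventTime_le := by have := h.eventTime_le; omega
  dense t₁ h₁ h₂ := h.dense t₁ (by omega) (by omega)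

theorem OnSchedule.event {d : ℕ} (hd : 0 < d) {t₀ t : ℤ} {s s' : PktGenState} {flow : List Event}
    (h : OnSchedule d t₀ t s flow) {e : Event} (he : e.time = t)
    (hs : s' = s ∨ s.eventTime ≤ t ∧ s' = ⟨s.eventTime + d, 0, 0⟩) :
    OnSchedule d t₀ (t + 1) s' (flow ++ [e]) := by
  have hle : s'.eventTime ≤ t + d := by
    rcases hs with rfl | ⟨hs, rfl⟩
    · exact h.eventTime_le
    · dsimp only
      omega
  refine ⟨?_, ?_, by omega, fun t₁ h₁ h₂ => ?_⟩
  · rcases hs with rfl | ⟨-, rfl⟩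
    exacts [h.batch, rfl]
  · rcases hs with rfl | ⟨-, rfl⟩
    exacts [h.packet, rfl]
  · exact (h.dense t le_rfl (le_max_left _ _)).append_singleton he (by omega) (by omega)

section Switch

variable {P : P4Program} {c : SwitchConfig} {σ σ' : SwitchState P} {ev : Option Event}

theorem IngressPacket.time_eq (h : IngressPacket P c σ ev σ') {e : Event} (he : e ∈ ev) :
    e.time = σ.t := by
  obtain ⟨-, -, pg, mi, src, pi, -, -, -, h⟩ := h
  rcases pi with _ | p
  · simp [h.1] at he
  · rcases h with ⟨-, rfl, -⟩ | ⟨_, _, _, _, _, _, -, rfl, -⟩ <;> cases he <;> rfl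

/-- What one clock tick of the ingress side amounts to from the point of view of the packet
generator: it is early for the next timer event, or passes on a recirculated packet, or generates a
packet. -/
theorem IngressPacket.generator {d : ℕ} (hc : c.pktgen.InjectsEvery d) (hb : σ.sg.batch = 0)
    (hp : σ.sg.packet = 0) (h : IngressPacket P c σ ev σ') :
    (σ'.sg = σ.sg ∧ σ.t < σ.sg.eventTime) ∨
    (σ'.sg = σ.sg ∧ σ.precirc.isSome ∧ ev.isSome) ∨
    (σ.sg.eventTime ≤ σ.t ∧ σ'.sg = ⟨σ.sg.eventTime + d, 0, 0⟩ ∧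
      ∃ e b k, ev = some e ∧ e.packet = generatedPacket c.pktgen σ.t b k) := by
  obtain ⟨-, -, pg, mi, src, pi, hgen, -, hin, h⟩ := h
  have hev : ∀ p, pg = some p → ∃ e, ev = some e ∧ e.packet = p := by
    rintro p rfl
    rcases hin with ⟨-, hpg, -⟩ | ⟨-, -, rfl⟩
    · cases hpg
    · rcases h with ⟨-, h, -⟩ | ⟨_, _, _, _, _, _, -, h, -⟩ <;> exact ⟨_, h, rfl⟩
  obtain ⟨hc₁, hc₂, hc₃⟩ := hc
  rcases hgen with ⟨hsg, hre, rfl, -⟩ | ⟨-, hgen, -⟩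
  · obtain ⟨p, hp⟩ := Option.isSome_iff_exists.1 hre
    obtain ⟨e, rfl, -⟩ := hev p hp
    exact .inr (.inl ⟨hsg.symm, hre, rfl⟩)
  · simp only [pktGen, hc₂, hc₃, PktGenState.due, hb, hp, Nat.cast_zero, zero_mul, add_zero,
      one_ne_zero, false_or] at hgen
    split_ifs at hgen with ht
    · exact .inl ⟨(Prod.mk.inj hgen).2.symm, ht⟩
    · obtain ⟨hpg, hsg⟩ := Prod.mk.inj hgen
      obtain ⟨e, he, hep⟩ := hev _ hpg.symm
      refine .inr (.inr ⟨not_lt.1 ht, ?_, e, _, _, he, hep⟩)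
      simp [← hsg, PktGenState.next, hb, hp, hc₁, hc₂, hc₃]

/-- If a filter keeps the generated and the recirculated packets, the filtered flow remains on
schedule in a clock tick of the ingress side. -/
theorem OnSchedule.ingressPacket {d : ℕ} (hd : 0 < d) (hc : c.pktgen.InjectsEvery d) {t₀ : ℤ}
    {flow : List Event} {q : Event → Bool} (hsch : OnSchedule d t₀ σ.t σ.sg (flow.filter q))
    (h : IngressPacket P c σ ev σ')
    (hre : ∀ e ∈ ev, σ.precirc.isSome → q e)
    (hgen : ∀ e ∈ ev, ∀ t b k, e.packet = generatedPacket c.pktgen t b k → q e) :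
    OnSchedule d t₀ σ'.t σ'.sg ((flow ++ ev.toList).filter q) := by
  rw [show σ'.t = σ.t + 1 by obtain ⟨-, -, _, _, _, _, -, h, -⟩ := h; exact h, List.filter_append]
  have key := h.generator hc hsch.batch hsch.packet
  have hadd : ∀ e ∈ ev, q e → (σ'.sg = σ.sg ∨
      σ.sg.eventTime ≤ σ.t ∧ σ'.sg = ⟨σ.sg.eventTime + d, 0, 0⟩) →
      OnSchedule d t₀ (σ.t + 1) σ'.sg (flow.filter q ++ ev.toList.filter q) := by
    intro e he hq hs
    have := h.time_eq he
    cases he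
    simpa [hq] using hsch.event hd this hs
  rcases key with ⟨hs, ht⟩ | ⟨hs, hpre, hev⟩ | ⟨ht, hs, e, b, k, rfl, hp⟩
  · by_cases hq : ∃ e ∈ ev, q e
    · obtain ⟨e, he, hq⟩ := hq
      exact hadd e he hq (.inl hs)
    · rw [List.filter_eq_nil_iff.2 fun e he hqe => hq ⟨e, Option.mem_toList.1 he, hqe⟩,
        List.append_nil, hs]
      exact hsch.idle ht
  · obtain ⟨e, rfl⟩ := Option.isSome_iff_exists.1 hev
    exact hadd e rfl (hre e rfl hpre) (.inl hs)
  · exact hadd e rfl (hgen e rfl _ _ _ hp) (.inr ⟨ht, hs⟩)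

theorem OnSchedule.denseFlow {d : ℕ} {t₀ t : ℤ} {s : PktGenState} {flow : List Event}
    (h : OnSchedule d t₀ t s flow) : DenseFlow d t₀ t flow :=
  h.dense t le_rfl (le_max_left _ _)

theorem ProcessPackets.denseFlow {d : ℕ} (hd : 0 < d) (hc : c.pktgen.InjectsEvery d)
    (hsg : σ.sg = .enabledAt c.pktgen σ.t) {flow : List Event}
    (h : ProcessPackets P c σ flow σ') : DenseFlow d σ.t σ'.t flow := by
  suffices OnSchedule d σ.t σ'.t σ'.sg (flow.filter fun _ => true) by
    simpa using this.denseFlow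
  induction h with
  | refl => simpa [hsg] using OnSchedule.enabledAt hc σ.t
  | ingress _ h ih => exact ih.ingressPacket hd hc h (by simp) (by simp)
  | egress _ h ih =>
    rw [← h.1, ← h.2.1]
    exact ih

end Switch

/-! ### The firewall in the switch -/

/-- Whether a packet was received by the switch. -/
def Source.isReceived (s : Source) : Bool := Source.casesOn s true false

namespace Firewall

variable {fw : Firewall}

/-- The firewall requests no multicast, so a packet has a copy only if it is forwarded. -/
theorem map_replicate_verdict {mc : McConfig} {s : fw.Table} {e : Event} {m : NormalMeta}
    {i : MirrorId} {p : RawPacket} (hout : e.out = some ((m, i), p))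
    (hv : e.out = fw.verdict s e.time e.packet) :
    (multicastEngine mc m ++ (unicastEngine m).toList).map (fun _ => p) =
      ((forwarded e).map Prod.snd).toList := by
  have hmc : multicastEngine mc m = [] := by
    rw [hout] at hv
    obtain ⟨⟨hd, l⟩, -, hr⟩ := Option.map_eq_some_iff.1 hv.symm
    obtain ⟨⟨rfl, -⟩, -⟩ := by simpa only [Prod.mk.injEq] using hr
    obtain _ | ⟨im, eth, ip⟩ := hd
    · simp [multicastEngine, control]
    · simp only [control]
      split_ifs <;> simp [multicastEngine]
  rw [hmc, forwarded, hout, unicastEngine]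
  dsimp only
  split_ifs
  · rfl
  · rcases m.1.ucastEgressPort with _ | port <;> rfl

/-- What holds along a run of the switch with the firewall program: besides the properties claimed
of the flow, the mirror buffer and the recirculation register stay empty, and the packets already
transmitted or still in the egress queues are, with multiplicity, among those forwarded. -/
structure Invariant (fw : Firewall) (c : SwitchConfig) (σ₀ : SwitchState fw.program)
    (flow : List Event) (σ : SwitchState fw.program) : Prop where
  onSchedule : OnSchedule (tenMs fw.ticksPerMs) σ₀.t σ.t σ.sg (controlFlow flow)
  pipelineRun : PipelineRun fw.program fw.initial flow σ.si
  precirc : σ.precirc = none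
  qmirror : σ.qmirror = []
  received : List.Perm
    ((flow.filter fun e => e.source.isReceived).map Event.packet ++ σ.qin) σ₀.qin
  transmitted : List.Subperm (σ.qout ++ σ.qegress.map Prod.snd)
    (flow.filterMap fun e => (forwarded e).map Prod.snd)

theorem pipelineRun_ingressPacket {P : P4Program} {c : SwitchConfig} {σ σ' : SwitchState P}
    {ev : Option Event} {s : P.IState} {flow : List Event} (hrun : PipelineRun P s flow σ.si)
    (h : IngressPacket P c σ ev σ') : PipelineRun P s (flow ++ ev.toList) σ'.si := by
  obtain ⟨-, -, pg, mi, src, pi, -, -, -, h⟩ := h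
  rcases pi with _ | p
  · obtain ⟨rfl, h, -⟩ := h
    simpa [← h] using hrun
  · rcases h with ⟨h, rfl, -⟩ | ⟨_, _, _, _, _, _, h, rfl, -⟩ <;> exact hrun.step h

theorem received_ingressPacket {P : P4Program} {c : SwitchConfig} {σ σ' : SwitchState P}
    {ev : Option Event} (h : IngressPacket P c σ ev σ') :
    List.Perm ((ev.toList.filter fun e => e.source.isReceived).map Event.packet ++ σ'.qin)
      σ.qin := by
  obtain ⟨-, -, pg, mi, src, pi, -, -, hin, h⟩ := h
  have hev : ∀ e ∈ ev, e.source = src ∧ pi = some e.packet := by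
    intro e he
    rcases pi with _ | p
    · simp [h.1] at he
    · rcases h with ⟨-, rfl, -⟩ | ⟨_, _, _, _, _, _, -, rfl, -⟩ <;> cases he <;> simp
  have hnone : ev = none → pi = none := by
    rintro rfl
    rcases pi with _ | p
    · rfl
    · rcases h with ⟨-, h, -⟩ | ⟨_, _, _, _, _, _, -, h, -⟩ <;> cases h
  rcases hin with ⟨rfl, -, ql, p, qr, rfl, hq, hq'⟩ | ⟨rfl, hq, -⟩
  · rcases ev with _ | e
    · cases hnone rfl
    · obtain ⟨hsrc, hp⟩ := hev e rfl
      cases hp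
      simpa [List.filter_cons, Source.isReceived, hsrc, hq, hq'] using List.perm_middle.symm
  · rcases ev with _ | e
    · simp [hq]
    · simp [Source.isReceived, hq, (hev e rfl).1]

theorem transmitted_ingressPacket {c : SwitchConfig} {σ σ' : SwitchState fw.program}
    {ev : Option Event} (hmirror : c.mirror = []) (hbuf : σ.qmirror = [])
    (h : IngressPacket fw.program c σ ev σ') :
    σ'.qmirror = [] ∧ σ'.qout = σ.qout ∧ ∃ l,
      σ'.qegress.map Prod.snd = σ.qegress.map Prod.snd ++ l ∧
      List.Sublist l (ev.toList.filterMap fun e => (forwarded e).map Prod.snd) := by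
  obtain ⟨-, hout, pg, mi, src, pi, -, -, -, h⟩ := h
  rw [← hout]
  rcases pi with _ | p
  · obtain ⟨rfl, -, hm, hq⟩ := h
    exact ⟨hm ▸ hbuf, rfl, [], by simp [hq], by simp⟩
  · rcases h with ⟨-, -, hm, hq⟩ |
      ⟨mnormal, idm, p', mmirror, mmerge, mrepl, hpipe, rfl, hlook, hmerge, hrepl, ms, hms, hq⟩
    · exact ⟨hm ▸ hbuf, rfl, [], by simp [hq], by simp⟩
    · obtain ⟨rfl, hm⟩ := hmerge ⟨hbuf, hlook hmirror⟩
      refine ⟨hm, rfl, ms.map fun _ => p', by simp [hq, Function.comp_def], ?_⟩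
      have := map_replicate_verdict (mc := c.mc)
        (e := ⟨σ.t, src, p, some ((mmerge, idm), p')⟩) rfl (ingressPipeline_program hpipe).1
      rw [hrepl] at hms
      have hsub := hms.map fun _ => p'
      rw [this] at hsub
      convert hsub using 1
      generalize hfwd : forwarded _ = o
      rcases o with _ | o <;> simp [hfwd]

theorem Invariant.ingress {c : SwitchConfig} {σ₀ σ σ' : SwitchState fw.program}
    {flow : List Event} {ev : Option Event} (hmirror : c.mirror = [])
    (hc : c.pktgen.InjectsEvery (tenMs fw.ticksPerMs)) (hinv : Invariant fw c σ₀ flow σ)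
    (h : IngressPacket fw.program c σ ev σ') : Invariant fw c σ₀ (flow ++ ev.toList) σ' := by
  have hrun := pipelineRun_ingressPacket hinv.pipelineRun h
  obtain ⟨hm, hqout, l, hl, hsub⟩ := transmitted_ingressPacket hmirror hinv.qmirror h
  refine ⟨?_, hrun, ?_, hm, ?_, ?_⟩
  · refine hinv.onSchedule.ingressPacket tenMs_pos hc h (by simp [hinv.precirc]) ?_
    -- The parser accepts the generated packets.
    rintro e he t b k hp
    cases he
    rw [(pipelineRun_program hrun).2 flow e [] rfl, verdict, Option.isSome_map, hp]
    exact fwParser_generatedPacket _ _ _ _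
  · obtain ⟨-, -, _, _, _, _, ⟨-, -, -, h⟩ | ⟨-, -, h⟩, -⟩ := h <;> exact h
  · rw [List.filter_append, List.map_append, List.append_assoc]
    exact ((received_ingressPacket h).append_left _).trans hinv.received
  · rw [hqout, hl, ← List.append_assoc, List.filterMap_append]
    exact hinv.transmitted.append hsub.subperm

theorem Invariant.egress {c : SwitchConfig} {σ₀ σ σ' : SwitchState fw.program}
    {flow : List Event} (hinv : Invariant fw c σ₀ flow σ)
    (h : EgressPacket fw.program σ σ') : Invariant fw c σ₀ flow σ' := by
  obtain ⟨ht, hsg, hsi, hqin, hm, -, me, pe, me', pe', ⟨ql, qr, hq, hq'⟩,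
    ⟨d1, l, d2, h3, h₁, -, h₂, rfl⟩, hports⟩ := h
  obtain ⟨-, rfl⟩ := Prod.mk.inj (show (d1, l) = ((), pe) from h₁)
  obtain ⟨rfl, rfl⟩ := Prod.mk.inj (show (me', h3) = (false, []) from h₂)
  obtain ⟨hqout, hpre⟩ : σ'.qout = σ.qout ++ [l] ∧ σ'.precirc = none := by
    simpa [OutputPorts] using hports
  refine ⟨?_, hsi ▸ hinv.pipelineRun, hpre, hm ▸ hinv.qmirror, hqin ▸ hinv.received, ?_⟩
  · rw [← ht, ← hsg]
    exact hinv.onSchedule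
  · refine List.Perm.subperm_right ?_ |>.2 hinv.transmitted
    rw [hqout, hq, hq', List.append_assoc]
    refine List.Perm.append_left _ ?_
    simpa only [List.map_append, List.map_cons, List.singleton_append] using
      List.perm_middle.symm

theorem invariant_of_processPackets {c : SwitchConfig} {σ σ' : SwitchState fw.program}
    {flow : List Event} (hmirror : c.mirror = [])
    (hc : c.pktgen.InjectsEvery (tenMs fw.ticksPerMs))
    (hsg : σ.sg = .enabledAt c.pktgen σ.t) (hsi : σ.si = fw.initial)
    (hpre : σ.precirc = none) (hbuf : σ.qmirror = []) (hq : σ.qegress = []) (hqout : σ.qout = [])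
    (h : ProcessPackets fw.program c σ flow σ') : Invariant fw c σ flow σ' := by
  induction h with
  | refl =>
    refine ⟨hsg ▸ OnSchedule.enabledAt hc σ.t, hsi ▸ .refl, hpre, hbuf, by simp, ?_⟩
    simp [hq, hqout]
  | ingress _ h ih => exact ih.ingress hmirror hc h
  | egress _ h ih => exact ih.egress h

end Firewall
end Tofino

/-! ### Density and correctness -/

theorem mainTheorem2 :
    -- Packet injection every 10 ms makes the flow dense, whatever the P4 program is.
    (∀ (P : Tofino.P4Program) (ticksPerMs : ℕ) (c : Tofino.SwitchConfig)
        (σ σ' : Tofino.SwitchState P) (flow : List Tofino.Event),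
      0 < ticksPerMs →
      c.pktgen.InjectsEvery (Tofino.tenMs ticksPerMs) →
      σ.sg = Tofino.PktGenState.enabledAt c.pktgen σ.t →
      Tofino.ProcessPackets P c σ flow σ' →
      Tofino.DenseFlow (Tofino.tenMs ticksPerMs) σ.t σ'.t flow) ∧
    -- The firewall program is correct on dense flows.
    (∀ (fw : Tofino.Firewall) (s' : fw.program.IState) (t₀ t₁ : ℤ) (flow : List Tofino.Event),
      Tofino.PipelineRun fw.program fw.initial flow s' →
      Tofino.DenseFlow (Tofino.tenMs fw.ticksPerMs) t₀ t₁ (Tofino.controlFlow flow) →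
      fw.Correct flow) ∧
    -- The firewall program with packet injection every 10 ms is correct for all inputs.
    (∀ (fw : Tofino.Firewall) (c : Tofino.SwitchConfig)
        (σ σ' : Tofino.SwitchState fw.program) (flow : List Tofino.Event),
      c.mirror = [] →
      c.pktgen.InjectsEvery (Tofino.tenMs fw.ticksPerMs) →
      σ.sg = Tofino.PktGenState.enabledAt c.pktgen σ.t →
      σ.si = fw.initial →
      σ.precirc = none → σ.qmirror = [] → σ.qegress = [] → σ.qout = [] →
      Tofino.ProcessPackets fw.program c σ flow σ' →
      Tofino.DenseFlow (Tofino.tenMs fw.ticksPerMs) σ.t σ'.t (Tofino.controlFlow flow) ∧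
      fw.Correct flow ∧
      List.Perm
        ((flow.filter fun e => e.source matches .received).map Tofino.Event.packet ++ σ'.qin)
        σ.qin ∧
      List.Subperm σ'.qout (flow.filterMap fun e => (Tofino.Firewall.forwarded e).map Prod.snd)) := by
  refine ⟨fun P ticksPerMs c σ σ' flow hpos hc hsg h => ?_, fun fw s' t₀ t₁ flow hrun hdense => ?_,
    fun fw c σ σ' flow hmirror hc hsg hsi hpre hbuf hq hqout h => ?_⟩
  · exact h.denseFlow (Nat.mul_pos (by norm_num) hpos) hc hsg
  · exact Tofino.Firewall.correct_of_dense hrun hdense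
  · have hinv := Tofino.Firewall.invariant_of_processPackets hmirror hc hsg hsi hpre hbuf hq hqout h
    have hdense := hinv.onSchedule.denseFlow
    refine ⟨hdense, Tofino.Firewall.correct_of_dense hinv.pipelineRun hdense, ?_,
      (List.sublist_append_left _ _).subperm.trans hinv.transmitted⟩
    convert hinv.received using 5 with e
    cases e.source <;> rfl
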